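/- Let $n\ge 2$, $\sigma=(1\,2)\in S_n$, let $\mathcal O=\mathcal O_{(12)}$ be the set of all transpositions $t_{ij}=(i\,j)$, $i\neq j$ (so $t_{ij}=t_{ji}$), and let $S_n^{\sigma}=\mathrm{Sym}\{3,\dots,n\}\times\mathrm{Sym}\{1,2\}$ be the centralizer of $\sigma$. Permutations are multiplied from right to left. Let $\chi: S_n^\sigma\to\mathbb C^\times$ be one of the two characters $\mathrm{sgn}\otimes\mathrm{sgn}$ or $\varepsilon\otimes\mathrm{sgn}$, where the first factor is a character of $\mathrm{Sym}\{3,\dots,n\}$ ($\varepsilon$ is the trivial one) and the second is the sign character of $\mathrm{Sym}\{1,2\}$. For $i<j$ put $g_{12}=\mathrm{id}$, $g_{1j}=(2\,j)$ and $g_{2j}=(1\,j)$ for $j>2$, and $g_{ij}=(1\,i)(2\,j)$ for $2<i<j$; put $g_{ji}=g_{ij}$. Then $g_{ij}^{-1}\sigma g_{ij}=t_{ij}$. For $h\in S_n$ define $\zeta_{ij}(h)\in S_n^\sigma$ by $g_{ij}h=\zeta_{ij}(h)\,g_{i'j'}$, where $t_{i'j'}=h^{-1}t_{ij}h$. Let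 $M(\mathcal O,\chi)$ be the Yetter–Drinfeld module over $\mathbb C S_n$ with basis $x_t$ ($t\in\mathcal O$), $x_t$ of degree $t$, and action $h\cdot x_{t_{ij}}=\chi(\zeta_{ij}(h^{-1})^{-1})\,x_{ht_{ij}h^{-1}}$, with braiding $c(x_t\otimes w)=(t\cdot w)\otimes x_t$. Let $\mathfrak B(\mathcal O_{(12)},\chi)=T(M)/\bigoplus_m\ker\mathfrak S_m$ be its Nichols algebra, where $M=M(\mathcal O,\chi)$ and $\mathfrak S_m$ is the $m$-th quantum symmetrizer of $c$. Let $Q$ be the quiver with vertex set $S_n$ and with exactly one arrow $a_{y,x}$ from $x$ to $y$ if $x^{-1}y\in\mathcal O$, and none otherwise. Its arrows span an $S_n$-bimodule through $g\cdot a_{y,x}=a_{gy,gx}$ and $a_{y,x}\cdot g=\chi(\zeta_{ij}(g))\,a_{yg,xg}$ if $x^{-1}y=t_{ij}$. The co-path Hopf algebra $\mathbb CQ^c$ has all paths of $Q$ as a basis (paths are written from right to left), and the product of two paths $p$ and $q$ is the sum over all shuffles of the arrows of $p$ with the arrows of $q$, where each arrow of $p$ is multiplied on the right by the vertex that has been reached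 on $q$, and each arrow of $q$ is multiplied on the left by the vertex that has been reached on $p$. Let $a_{ij}$ ($i\ne j$, so that $a_{ij}=a_{ji}$) denote the generator $x_{t_{ij}}$ of $\mathfrak B(\mathcal O_{(12)},\chi)$, and also the arrow $a_{t_{ij},1}$ in $\mathbb CQ^c$. For distinct $i,j,k\in\{1,\dots,n\}$ consider the statement $(*)_{ijk}$: there are $\alpha_{ijk},\beta_{ijk}\in\{1,-1\}$ with $$a_{ij}a_{jk}+\alpha_{ijk}\,a_{jk}a_{ki}+\beta_{ijk}\,a_{ki}a_{ij}=0 .$$ Then the following hold, where (i), (iii), (iv), (v) hold both in $\mathfrak B(\mathcal O_{(12)},\chi)$ and in $\mathbb CQ^c$. (i) $(*)_{ijk}$ holds for all distinct $i,j,k$. (ii) For all distinct $i,j,k$ and all $\alpha_{ijk},\beta_{ijk}\in\{1,-1\}$ one has in $\mathbb CQ^c$ $$\begin{aligned}a_{ij}a_{jk}+\alpha_{ijk}a_{jk}a_{ki}+\beta_{ijk}a_{ki}a_{ij}={}&\bigl(\chi(\zeta_{ij}(t_{jk}))\,a_{t_{ij}t_{jk},t_{jk}}a_{t_{jk},1}+a_{t_{ij}t_{jk},t_{ij}}a_{t_{ij},1}\bigr)\\&+\alpha_{ijk}\bigl(\chi(\zeta_{jk}(t_{ik}))\,a_{t_{jk}t_{ik},t_{ik}}a_{t_{ik},1}+a_{t_{jk}t_{ik},t_{jk}}a_{t_{jk},1}\bigr)\\&+\beta_{ijk}\bigl(\chi(\zeta_{ik}(t_{ij}))\,a_{t_{ik}t_{ij},t_{ij}}a_{t_{ij},1}+a_{t_{ik}t_{ij},t_{ik}}a_{t_{ik},1}\bigr).\end{aligned}$$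 (iii) For distinct $i,j,k$, if $\chi(\zeta_{ij}(t_{jk}))\,\chi(\zeta_{jk}(t_{ik}))\,\chi(\zeta_{ik}(t_{ij}))=-1$, then $(*)_{ijk}$ holds. (iv) For distinct $i,j,k$, $(*)_{ijk}$ holds if and only if $\chi(\zeta_{ij}(t_{jk}))\,\chi(\zeta_{jk}(t_{ik}))\,\chi(\zeta_{ik}(t_{ij}))=-1$. (v) For distinct $i,j,k,l$ there is $\lambda_{ijkl}\in\{1,-1\}$ with $a_{ij}a_{kl}=\lambda_{ijkl}\,a_{kl}a_{ij}$. -/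

import Mathlib

open scoped TensorProduct

noncomputable section

/-! ### Nichols algebras of braided vector spaces -/

namespace Nichols

variable {k : Type*} [Field k] {V : Type*} [AddCommGroup V] [Module k V]

/-- The map `V ⊗ T(V) → T(V)`, `v ⊗ z ↦ v z`. -/
def mulLeft : V ⊗[k] TensorAlgebra k V →ₗ[k] TensorAlgebra k V :=
  TensorProduct.lift ((LinearMap.mul k (TensorAlgebra k V)).comp (TensorAlgebra.ι k))

/-- For a linear map `c : V ⊗ V → V ⊗ V`, the map `V ⊗ (V ⊗ T(V)) → V ⊗ T(V)` which sends
`x ⊗ (y ⊗ z)` to `∑ y' ⊗ (x' z)`, where `c (x ⊗ y) = ∑ y' ⊗ x'`. -/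
def cross (c : V ⊗[k] V →ₗ[k] V ⊗[k] V) :
    V ⊗[k] (V ⊗[k] TensorAlgebra k V) →ₗ[k] V ⊗[k] TensorAlgebra k V :=
  (LinearMap.lTensor V mulLeft) ∘ₗ
    (TensorProduct.assoc k V V (TensorAlgebra k V)).toLinearMap ∘ₗ
    (LinearMap.rTensor (TensorAlgebra k V) c) ∘ₗ
    (TensorProduct.assoc k V V (TensorAlgebra k V)).symm.toLinearMap

/-- The operator `(z, f) ↦ (x z, x ⊗ z + cross c (x ⊗ f))` on `T(V) × (V ⊗ T(V))`,
for `x` in `V`. -/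
def frontStep (c : V ⊗[k] V →ₗ[k] V ⊗[k] V) :
    V →ₗ[k] Module.End k (TensorAlgebra k V × (V ⊗[k] TensorAlgebra k V)) :=
  TensorProduct.curry
    (LinearMap.prod
      (mulLeft ∘ₗ LinearMap.lTensor V (LinearMap.fst k _ _))
      (LinearMap.lTensor V (LinearMap.fst k _ _) +
        cross c ∘ₗ LinearMap.lTensor V (LinearMap.snd k _ _)))

/-- The linear map `T(V) → V ⊗ T(V)` with `front c 1 = 0` and
`front c (x z) = x ⊗ z + cross c (x ⊗ front c z)` for `x` in `V`. On `V^{⊗ m}`, with `c_i` the map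
`c` applied to the factors `i` and `i + 1`, it is `1 + c_1 + c_1 c_2 + ⋯ + c_1 c_2 ⋯ c_{m-1}`,
the first factor of the result being the one in `V`. -/
def front (c : V ⊗[k] V →ₗ[k] V ⊗[k] V) :
    TensorAlgebra k V →ₗ[k] V ⊗[k] TensorAlgebra k V :=
  LinearMap.snd k _ _ ∘ₗ
    LinearMap.applyₗ ((1, 0) : TensorAlgebra k V × (V ⊗[k] TensorAlgebra k V)) ∘ₗ
    (TensorAlgebra.lift k (frontStep c)).toLinearMap

/-- The `m`-th quantum symmetrizer `𝔖_m`, the sum over all permutations `w` of `m` letters of the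
maps `c_{i_1} ⋯ c_{i_r}` given by a reduced decomposition of `w`. It acts on the component
`V^{⊗ m}` of `T(V)` through the factorization
`𝔖_{m+1} = (id_V ⊗ 𝔖_m) (1 + c_1 + c_1 c_2 + ⋯ + c_1 ⋯ c_m)`,
and it is extended by `0` to the other homogeneous components. -/
def qSymm (c : V ⊗[k] V →ₗ[k] V ⊗[k] V) : ℕ → TensorAlgebra k V →ₗ[k] TensorAlgebra k V
  | 0 => Algebra.linearMap k (TensorAlgebra k V) ∘ₗ TensorAlgebra.algebraMapInv.toLinearMap
  | m + 1 => mulLeft ∘ₗ LinearMap.lTensor V (qSymm c m) ∘ₗ front c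

/-- The Nichols algebra `𝔅(V) = T(V) / ⨁ₘ ker 𝔖_m` of a braided vector space `(V, c)`. -/
def NicholsAlgebra (c : V ⊗[k] V →ₗ[k] V ⊗[k] V) : Type _ :=
  RingQuot (fun x y : TensorAlgebra k V => ∀ m, qSymm c m x = qSymm c m y)

instance (c : V ⊗[k] V →ₗ[k] V ⊗[k] V) : Ring (NicholsAlgebra c) :=
  inferInstanceAs (Ring (RingQuot _))

instance (c : V ⊗[k] V →ₗ[k] V ⊗[k] V) : Algebra k (NicholsAlgebra c) :=
  inferInstanceAs (Algebra k (RingQuot _))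

/-- The image in the Nichols algebra of a vector of `V`. -/
def NicholsAlgebra.ι (c : V ⊗[k] V →ₗ[k] V ⊗[k] V) : V →ₗ[k] NicholsAlgebra c :=
  (RingQuot.mkAlgHom k (fun x y : TensorAlgebra k V =>
    ∀ m, qSymm c m x = qSymm c m y)).toLinearMap ∘ₗ TensorAlgebra.ι k

end Nichols

/-! ### The Yetter–Drinfeld module of a conjugacy class and a character of the centralizer -/

namespace BiOne

variable {G : Type*} [Group G]

/-- The centralizer `G^s`. -/
abbrev Cent (s : G) : Subgroup G := Subgroup.centralizer {s}

/-- The conjugacy class `𝒪_s`. -/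
abbrev Orb (s : G) : Type _ := ↥(conjugatesOf s)

/-- A family `(g_t)`, indexed by `t ∈ 𝒪_s`, with `g_t⁻¹ s g_t = t`; equivalently, a system of
representatives `G = ⋃ G^s g_t` of the right cosets of the centralizer. -/
structure Reps (s : G) where
  rep : Orb s → G
  rep_spec : ∀ t, (rep t)⁻¹ * s * rep t = t

theorem conj_mem {s t : G} (ht : t ∈ conjugatesOf s) (h : G) : h * t * h⁻¹ ∈ conjugatesOf s :=
  IsConj.trans ht (isConj_iff.2 ⟨h, rfl⟩)

/-- The conjugate `h ▷ t = h t h⁻¹`, as an element of the conjugacy class. -/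
def conj {s : G} (h : G) (t : Orb s) : Orb s := ⟨h * t * h⁻¹, conj_mem t.2 h⟩

theorem zeta_mem {s : G} (R : Reps s) (t : Orb s) (h : G) :
    R.rep t * h * (R.rep (conj h⁻¹ t))⁻¹ ∈ Cent s := by
  rw [Subgroup.mem_centralizer_singleton_iff]
  have h1 : (R.rep t)⁻¹ * s * R.rep t = t := R.rep_spec t
  have h2 : (R.rep (conj h⁻¹ t))⁻¹ * s * R.rep (conj h⁻¹ t) = h⁻¹ * t * h⁻¹⁻¹ :=
    R.rep_spec (conj h⁻¹ t)
  generalize R.rep (conj h⁻¹ t) = b at *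
  rw [← h1] at h2
  generalize R.rep t = c at *
  have h3 : s * b = b * (h⁻¹ * (c⁻¹ * s * c) * h⁻¹⁻¹) := by rw [← h2]; group
  have h4 : b⁻¹ * s = h⁻¹ * (c⁻¹ * s * c) * h⁻¹⁻¹ * b⁻¹ := by rw [← h2]; group
  rw [mul_assoc (c * h), h4]
  group

/-- The element `ζ_t(h) ∈ G^s` defined by `g_t h = ζ_t(h) g_{t'}`, where `t' = h⁻¹ t h`. -/
def zeta {s : G} (R : Reps s) (t : Orb s) (h : G) : Cent s :=
  ⟨R.rep t * h * (R.rep (conj h⁻¹ t))⁻¹, zeta_mem R t h⟩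

variable {k : Type*} [Field k]

/-- The underlying space of `M(𝒪_s, χ)`; the basis vector `x_t = Finsupp.single t 1`, homogeneous of
degree `t` for the coaction of `G`, is the vector `g_t⁻¹ ⊗ 1`. -/
abbrev YD (k : Type*) [Field k] {G : Type*} [Group G] (s : G) : Type _ := Orb s →₀ k

/-- The action of `G` on `M(𝒪_s, χ)`: `h · x_t = χ(γ) x_{h t h⁻¹}`, where
`h g_t⁻¹ = g_{h t h⁻¹}⁻¹ γ` with `γ ∈ G^s`, that is, `γ = ζ_t(h⁻¹)⁻¹`. -/
def act {s : G} (R : Reps s) (χ : Cent s →* kˣ) (h : G) : YD k s →ₗ[k] YD k s :=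
  Finsupp.linearCombination k fun t =>
    Finsupp.single (conj h t) ((χ (zeta R t h⁻¹)⁻¹ : kˣ) : k)

/-- The braiding of `M(𝒪_s, χ)`: `c (x_t ⊗ w) = (t · w) ⊗ x_t`. -/
def braiding {s : G} (R : Reps s) (χ : Cent s →* kˣ) :
    YD k s ⊗[k] YD k s →ₗ[k] YD k s ⊗[k] YD k s :=
  TensorProduct.lift <| Finsupp.linearCombination k fun t =>
    ((TensorProduct.mk k (YD k s) (YD k s)).flip (Finsupp.single t 1)) ∘ₗ act R χ (t : G)

/-- The Nichols algebra `𝔅(𝒪_s, χ)` of `M(𝒪_s, χ)`. -/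
abbrev NicholsOrb {s : G} (R : Reps s) (χ : Cent s →* kˣ) : Type _ :=
  Nichols.NicholsAlgebra (braiding R χ)

/-- The generator of `𝔅(𝒪_s, χ)` attached to `t ∈ 𝒪_s`. -/
def gen {s : G} (R : Reps s) (χ : Cent s →* kˣ) (t : Orb s) : NicholsOrb R χ :=
  Nichols.NicholsAlgebra.ι (braiding R χ) (Finsupp.single t 1)

/-! ### The co-path Hopf algebra of the Hopf quiver -/

/-- The vertices of the Hopf quiver of the ramification `𝒪_s`: the elements of `G`. -/
def HopfQuiver {G : Type*} [Group G] (_s : G) : Type _ := G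

instance (s : G) : Group (HopfQuiver s) := inferInstanceAs (Group G)

/-- An element of `G` as a vertex. -/
abbrev vtx (s : G) (x : G) : HopfQuiver s := x

/-- A vertex as an element of `G`. -/
abbrev HopfQuiver.val {s : G} (x : HopfQuiver s) : G := x

/-- There is exactly one arrow from `x` to `y`, written `a_{y,x}`, if `x⁻¹ y ∈ 𝒪_s`, and none
otherwise. -/
instance (s : G) : Quiver (HopfQuiver s) :=
  ⟨fun x y => PLift (x.val⁻¹ * y.val ∈ conjugatesOf s)⟩

/-- The element `x⁻¹ y` of `𝒪_s` attached to the arrow `a_{y,x}`. -/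
def arrowType {s : G} {x y : HopfQuiver s} (a : x ⟶ y) : Orb s :=
  ⟨x.val⁻¹ * y.val, a.down⟩

/-- The translate `a_{gy,gx}` of `a_{y,x}`. -/
def arrowL {s : G} (g : HopfQuiver s) {x y : HopfQuiver s} (a : x ⟶ y) : g * x ⟶ g * y :=
  ⟨by
    have h : (g.val * x.val)⁻¹ * (g.val * y.val) = x.val⁻¹ * y.val := by group
    change (g.val * x.val)⁻¹ * (g.val * y.val) ∈ conjugatesOf s
    rw [h]
    exact a.down⟩

/-- The translate `a_{yg,xg}` of `a_{y,x}`. -/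
def arrowR {s : G} {x y : HopfQuiver s} (a : x ⟶ y) (g : HopfQuiver s) : x * g ⟶ y * g :=
  ⟨by
    have h : (x.val * g.val)⁻¹ * (y.val * g.val) =
        g.val⁻¹ * (x.val⁻¹ * y.val) * g.val⁻¹⁻¹ := by group
    change (x.val * g.val)⁻¹ * (y.val * g.val) ∈ conjugatesOf s
    rw [h]
    exact conj_mem a.down g.val⁻¹⟩

/-- The product of two paths in the co-path Hopf algebra of the `kG`-Hopf bimodule spanned by the
arrows, with `g · a_{y,x} = a_{gy,gx}` and `a_{y,x} · g = χ(ζ_{x⁻¹y}(g)) a_{yg,xg}`. It is the sum,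
over all shuffles of the arrows of the two paths, of the paths in which every arrow of the first
path is multiplied on the right by the current vertex of the second path, and every arrow of the
second path is multiplied on the left by the current vertex of the first path. The recursion is on
the last arrow. -/
def pathMul {s : G} (R : Reps s) (χ : Cent s →* kˣ) : {u x v y : HopfQuiver s} →
    Quiver.Path u x → Quiver.Path v y → (Quiver.Path (u * v) (x * y) →₀ k)
  | _, _, _, _, .nil, .nil => Finsupp.single .nil 1
  | _, _, _, _, .nil (a := u), .cons q b =>
      (pathMul R χ (.nil (a := u)) q).mapDomain fun r => r.cons (arrowL u b)
  | _, _, _, _, .cons p a, .nil (a := v) =>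
      ((χ (zeta R (arrowType a) v.val) : kˣ) : k) •
        (pathMul R χ p (.nil (a := v))).mapDomain fun r => r.cons (arrowR a v)
  | _, x, _, y, .cons p a, .cons q b =>
      ((χ (zeta R (arrowType a) y.val) : kˣ) : k) •
        (pathMul R χ p (.cons q b)).mapDomain (fun r => r.cons (arrowR a y)) +
      (pathMul R χ (.cons p a) q).mapDomain fun r => r.cons (arrowL x b)
  termination_by _ _ _ _ p q => p.length + q.length

/-- The vector space with basis all paths of the Hopf quiver. -/
abbrev PathSpace (k : Type*) [Field k] {G : Type*} [Group G] (s : G) : Type _ :=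
  (Σ x y : HopfQuiver s, Quiver.Path x y) →₀ k

/-- The bilinear extension to `PathSpace k s` of the product of paths. -/
def pathMulₗ {s : G} (R : Reps s) (χ : Cent s →* kˣ) :
    PathSpace k s →ₗ[k] PathSpace k s →ₗ[k] PathSpace k s :=
  Finsupp.linearCombination k fun p => Finsupp.linearCombination k fun q =>
    (pathMul R χ p.2.2 q.2.2).mapDomain fun r => ⟨p.1 * q.1, p.2.1 * q.2.1, r⟩

/-- The co-path Hopf algebra, as the space `PathSpace k s` with the multiplication `pathMulₗ`. -/
def CoPath {s : G} (_R : Reps s) (_χ : Cent s →* kˣ) : Type _ := PathSpace k s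

instance {s : G} (R : Reps s) (χ : Cent s →* kˣ) : AddCommGroup (CoPath R χ) :=
  inferInstanceAs (AddCommGroup (PathSpace k s))

instance {s : G} (R : Reps s) (χ : Cent s →* kˣ) : Module k (CoPath R χ) :=
  inferInstanceAs (Module k (PathSpace k s))

/-- The co-path Hopf algebra as a vector space. -/
def CoPath.equiv {s : G} (R : Reps s) (χ : Cent s →* kˣ) : CoPath R χ ≃ₗ[k] PathSpace k s :=
  LinearEquiv.refl k (PathSpace k s)

/-- A path of the Hopf quiver, as an element of the co-path Hopf algebra. -/
def CoPath.of {s : G} (R : Reps s) (χ : Cent s →* kˣ) {x y : HopfQuiver s}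
    (p : Quiver.Path x y) : CoPath R χ :=
  (CoPath.equiv R χ).symm (Finsupp.single ⟨x, y, p⟩ 1)

instance {s : G} (R : Reps s) (χ : Cent s →* kˣ) : Mul (CoPath R χ) :=
  ⟨fun f g => (CoPath.equiv R χ).symm
    (pathMulₗ R χ (CoPath.equiv R χ f) (CoPath.equiv R χ g))⟩

/-- The arrow `a_{t,1}`. -/
def arrowOne {s : G} (t : Orb s) : vtx s 1 ⟶ vtx s t :=
  ⟨by
    change (1 : G)⁻¹ * (t : G) ∈ conjugatesOf s
    rw [inv_one, one_mul]
    exact t.2⟩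

/-- The arrow `a_{t t', t'}`. -/
def arrowToMulL {s : G} (t t' : Orb s) : vtx s t' ⟶ vtx s (t * t') :=
  ⟨by
    have h : (t' : G)⁻¹ * (t * t' : G) = (t' : G)⁻¹ * t * ((t' : G)⁻¹)⁻¹ := by group
    change (t' : G)⁻¹ * (t * t' : G) ∈ conjugatesOf s
    rw [h]
    exact conj_mem t.2 _⟩

/-- The arrow `a_{t t', t}`. -/
def arrowToMulR {s : G} (t t' : Orb s) : vtx s t ⟶ vtx s (t * t') :=
  ⟨by
    have h : (t : G)⁻¹ * (t * t' : G) = t' := by group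
    change (t : G)⁻¹ * (t * t' : G) ∈ conjugatesOf s
    rw [h]
    exact t'.2⟩

/-- The arrow `a_t = a_{t,1}`, as an element of the co-path Hopf algebra. -/
def arr {s : G} (R : Reps s) (χ : Cent s →* kˣ) (t : Orb s) : CoPath R χ :=
  CoPath.of R χ (Quiver.Path.nil.cons (arrowOne t))

/-- The 2-path `a_{t t', t'} a_{t', 1}`. -/
def pathVia₂ {s : G} (R : Reps s) (χ : Cent s →* kˣ) (t t' : Orb s) : CoPath R χ :=
  CoPath.of R χ ((Quiver.Path.nil.cons (arrowOne t')).cons (arrowToMulL t t'))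

/-- The 2-path `a_{t t', t} a_{t, 1}`. -/
def pathVia₁ {s : G} (R : Reps s) (χ : Cent s →* kˣ) (t t' : Orb s) : CoPath R χ :=
  CoPath.of R χ ((Quiver.Path.nil.cons (arrowOne t)).cons (arrowToMulR t t'))

end BiOne

/-! ### Transpositions in the symmetric group -/

namespace Transp

open Equiv

variable {n : ℕ} [n.AtLeastTwo]

theorem zero_ne_one' : (0 : Fin n) ≠ 1 := by
  have h := Nat.AtLeastTwo.one_lt (n := n)
  intro e
  have := congrArg Fin.val e
  rw [Fin.val_one', Nat.mod_eq_of_lt h] at this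
  simp at this

/-- The transposition `(1 2)`; the letters `1, …, n` are `0, …, n - 1` here. -/
abbrev σ (n : ℕ) [n.AtLeastTwo] : Perm (Fin n) := swap 0 1

/-- The transposition `t_{ij} = (i j)`, as an element of the conjugacy class of `(1 2)`. -/
def t {i j : Fin n} (h : i ≠ j) : BiOne.Orb (σ n) :=
  ⟨swap i j, Perm.isConj_swap zero_ne_one' h⟩

/-- The elements `g_{ij}` for `i < j`: `g_{12} = id`, `g_{1j} = (2 j)` and `g_{2j} = (1 j)` for
`j > 2`, and `g_{ij} = (1 i)(2 j)` for `2 < i < j`. -/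
def g (i j : Fin n) : Perm (Fin n) :=
  if i = 0 then (if j = 1 then 1 else swap 1 j)
  else if i = 1 then swap 0 j
  else swap 0 i * swap 1 j

theorem exists_lt (τ : BiOne.Orb (σ n)) : ∃ p : Fin n × Fin n, p.1 < p.2 ∧ (τ : Perm (Fin n)) =
    swap p.1 p.2 := by
  obtain ⟨τ, hτ⟩ := τ
  obtain ⟨c, hc⟩ := isConj_iff.1 hτ
  have h : τ = swap (c 0) (c 1) := by rw [← hc, Equiv.swap_apply_apply]
  have hne : c 0 ≠ c 1 := fun e => zero_ne_one' (c.injective e)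
  rcases lt_or_gt_of_ne hne with h' | h'
  · exact ⟨(c 0, c 1), h', h⟩
  · exact ⟨(c 1, c 0), h', h.trans (swap_comm _ _)⟩

theorem g_spec {i j : Fin n} (h : i < j) : (g i j)⁻¹ * σ n * g i j = swap i j := by
  have h01 := zero_ne_one' (n := n)
  have key : ∀ c : Perm (Fin n), c⁻¹ * σ n * c = swap (c⁻¹ 0) (c⁻¹ 1) := fun c => by
    rw [Equiv.swap_apply_apply, inv_inv]
  have hj0 : j ≠ 0 := fun e => absurd h (by simp [e])
  rw [key]
  unfold g
  split_ifs with h1 h2 h2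
  · simp [h1, h2]
  · subst h1
    rw [swap_inv, swap_apply_left, swap_apply_of_ne_of_ne h01 (Ne.symm hj0)]
  · subst h2
    rw [swap_inv, swap_apply_left, swap_apply_of_ne_of_ne h01.symm (ne_of_lt h), swap_comm]
  · have hj1 : j ≠ 1 := by
      rintro rfl
      apply h1
      ext
      have := Fin.lt_def.1 h
      have h2 := Nat.AtLeastTwo.one_lt (n := n)
      rw [Fin.val_one', Nat.mod_eq_of_lt h2] at this
      rw [Fin.val_zero]
      exact Nat.lt_one_iff.1 this
    rw [mul_inv_rev, swap_inv, swap_inv, Perm.mul_apply, Perm.mul_apply, swap_apply_left,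
      swap_apply_of_ne_of_ne h2 (ne_of_lt h), swap_apply_of_ne_of_ne h01.symm (Ne.symm h2),
      swap_apply_left]

/-- The representatives `g_{ij}`, attached to the transpositions `(i j)`, `i < j`. -/
def reps (n : ℕ) [n.AtLeastTwo] : BiOne.Reps (σ n) where
  rep τ := g (exists_lt τ).choose.1 (exists_lt τ).choose.2
  rep_spec τ := by
    rw [g_spec (exists_lt τ).choose_spec.1]
    exact (exists_lt τ).choose_spec.2.symm

theorem mem_cent_iff {c : Perm (Fin n)} (hc : c ∈ BiOne.Cent (σ n)) (x : Fin n) :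
    (c x = 0 ∨ c x = 1) ↔ (x = 0 ∨ x = 1) := by
  have h01 := zero_ne_one' (n := n)
  have h : swap (c 0) (c 1) = σ n := by
    rw [Equiv.swap_apply_apply]
    rw [Subgroup.mem_centralizer_singleton_iff.1 hc]
    group
  have h0 : c 0 ≠ c 1 := fun e => h01 (c.injective e)
  have h1 : (c 0 = 0 ∧ c 1 = 1) ∨ (c 0 = 1 ∧ c 1 = 0) := by
    have e0 : swap (c 0) (c 1) 0 = 1 := by rw [h, swap_apply_left]
    rw [swap_apply_def] at e0
    split_ifs at e0 with a b
    · exact Or.inl ⟨a.symm, e0⟩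
    · exact Or.inr ⟨e0, b.symm⟩
    · exact absurd e0 h01
  constructor
  · rintro (hx | hx) <;> rcases h1 with ⟨p, q⟩ | ⟨p, q⟩
    · exact Or.inl (c.injective (hx.trans p.symm))
    · exact Or.inr (c.injective (hx.trans q.symm))
    · exact Or.inr (c.injective (hx.trans q.symm))
    · exact Or.inl (c.injective (hx.trans p.symm))
  · rintro (rfl | rfl) <;> rcases h1 with ⟨p, q⟩ | ⟨p, q⟩ <;> simp [p, q]

/-- The restriction to `{1, 2}` of an element of the centralizer of `(1 2)`. -/
def resTwo (n : ℕ) [n.AtLeastTwo] :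
    BiOne.Cent (σ n) →* Perm {x : Fin n // x = 0 ∨ x = 1} where
  toFun c := (c : Perm (Fin n)).subtypePerm fun x => mem_cent_iff c.2 x
  map_one' := rfl
  map_mul' _ _ := rfl

/-- The restriction to `{3, …, n}` of an element of the centralizer of `(1 2)`. -/
def resRest (n : ℕ) [n.AtLeastTwo] :
    BiOne.Cent (σ n) →* Perm {x : Fin n // ¬ (x = 0 ∨ x = 1)} where
  toFun c := (c : Perm (Fin n)).subtypePerm fun x => not_congr (mem_cent_iff c.2 x)
  map_one' := rfl
  map_mul' _ _ := rfl

/-- The character `μ ⊗ ν` of the centralizer `Sym {3, …, n} × Sym {1, 2}` of `(1 2)`, where `μ` and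
`ν` are `±1`-valued characters of `Sym {3, …, n}` and of `Sym {1, 2}`. -/
def tensorChar (k : Type*) [Field k] (μ : Perm {x : Fin n // ¬ (x = 0 ∨ x = 1)} →* ℤˣ)
    (ν : Perm {x : Fin n // x = 0 ∨ x = 1} →* ℤˣ) : BiOne.Cent (σ n) →* kˣ :=
  (Units.map (Int.castRingHom k).toMonoidHom).comp (μ.comp (resRest n) * ν.comp (resTwo n))

/-- The character `sgn ⊗ sgn`. -/
def sgnSgn (k : Type*) [Field k] (n : ℕ) [n.AtLeastTwo] : BiOne.Cent (σ n) →* kˣ :=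
  tensorChar k Perm.sign Perm.sign

/-- The character `ε ⊗ sgn`, with `ε` the trivial character. -/
def epsSgn (k : Type*) [Field k] (n : ℕ) [n.AtLeastTwo] : BiOne.Cent (σ n) →* kˣ :=
  tensorChar k 1 Perm.sign

/-- The scalar `χ(ζ_{ij}(τ))`. -/
def chiZeta {k : Type*} [Field k] (χ : BiOne.Cent (σ n) →* kˣ) {i j : Fin n} (h : i ≠ j)
    (τ : Perm (Fin n)) : k :=
  ((χ (BiOne.zeta (reps n) (t h) τ) : kˣ) : k)

/-- The generator `a_{ij}` of the Nichols algebra `𝔅(𝒪_{(1 2)}, χ)`. -/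
abbrev x {k : Type*} [Field k] (χ : BiOne.Cent (σ n) →* kˣ) {i j : Fin n} (h : i ≠ j) :
    BiOne.NicholsOrb (reps n) χ :=
  BiOne.gen (reps n) χ (t h)

/-- The arrow `a_{ij}` from `1` to `(i j)` in the co-path Hopf algebra. -/
abbrev a {k : Type*} [Field k] (χ : BiOne.Cent (σ n) →* kˣ) {i j : Fin n} (h : i ≠ j) :
    BiOne.CoPath (reps n) χ :=
  BiOne.arr (reps n) χ (t h)

end Transp

/-- The relation `u v + α v w + β w u = 0` holds for some signs `α` and `β`. -/
def ThreeTerm (k : Type*) [Field k] {A : Type*} [AddCommGroup A] [Module k A] [Mul A]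
    (u v w : A) : Prop :=
  ∃ α ∈ ({1, -1} : Set k), ∃ β ∈ ({1, -1} : Set k),
    u * v + α • (v * w) + β • (w * u) = 0

/-- The relation `u v = c v u` holds for some sign `c`. -/
def SignCommute (k : Type*) [Field k] {A : Type*} [AddCommGroup A] [Module k A] [Mul A]
    (u v : A) : Prop :=
  ∃ c ∈ ({1, -1} : Set k), u * v = c • (v * u)

end

/-!
The product of two arrows at the identity is `a_t a_{t'} = χ(ζ_t(t')) B + A`, where `A` and `B` are
the 2-paths from `1` to `t t'` through `t` and through `t'` respectively. For distinct `i, j, k` the products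
`t_{ij} t_{jk} = t_{jk} t_{ki} = t_{ki} t_{ij}` are the same 3-cycle, so the three products of arrows
involve only the three 2-paths to this vertex, and a three-term relation exists as soon as the three
scalars multiply to `-1`. In the Nichols algebra a quadratic element `z` vanishes as soon as
`z + c z = 0`, since in degree two every quantum symmetrizer of positive index starts with `1 + c`;
the braiding also permutes three tensors cyclically, and the product condition is the one for the
reversed triple.

That the product is always `-1` does not depend on the representatives `g_t`. On the centralizer
`sgn ⊗ sgn` is the restriction of the sign of `S_n`, and the signs of the `g_t` cancel in pairs,
leaving the sign of a product of three transpositions. The character `ε ⊗ sgn` tells whether an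
element of the centralizer exchanges `1` and `2`; a representative `g_t` orients the pair moved by
`t`, each factor compares the orientations of two sides of the triangle `i j k` at their common
vertex, and over the three vertices each of the three sides contributes `-1`. For disjoint
transpositions both scalars are the same sign, which gives the commutation.
-/

/-! ### Quadratic relations in a Nichols algebra -/

namespace Nichols

variable {k : Type*} [Field k] {V : Type*} [AddCommGroup V] [Module k V]

theorem mulLeft_tmul (v : V) (z : TensorAlgebra k V) :
    mulLeft (v ⊗ₜ[k] z) = TensorAlgebra.ι k v * z := rfl

/-- The embedding `V ⊗ V → T(V)` as the component of degree two. -/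
def quadratic : V ⊗[k] V →ₗ[k] TensorAlgebra k V :=
  mulLeft ∘ₗ LinearMap.lTensor V (TensorAlgebra.ι k)

theorem front_one (c : V ⊗[k] V →ₗ[k] V ⊗[k] V) : front c 1 = 0 := by
  simp [front]

theorem frontStep_lift_fst (c : V ⊗[k] V →ₗ[k] V ⊗[k] V) (z w : TensorAlgebra k V)
    (f : V ⊗[k] TensorAlgebra k V) :
    (TensorAlgebra.lift k (frontStep c) z (w, f)).1 = z * w := by
  induction z using TensorAlgebra.induction generalizing w f with
  | algebraMap r => simp [Algebra.smul_def]
  | ι v => simp [frontStep, mulLeft_tmul]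
  | mul a b ha hb =>
    rw [map_mul, Module.End.mul_apply, mul_assoc, ← hb w f]
    exact ha _ _
  | add a b ha hb => simp [ha, hb, add_mul]

theorem front_ι_mul (c : V ⊗[k] V →ₗ[k] V ⊗[k] V) (v : V) (z : TensorAlgebra k V) :
    front c (TensorAlgebra.ι k v * z) = v ⊗ₜ z + cross c (v ⊗ₜ front c z) := by
  have h := frontStep_lift_fst c z 1 0
  rw [mul_one] at h
  simp only [front, LinearMap.comp_apply, AlgHom.toLinearMap_apply, map_mul,
    TensorAlgebra.lift_ι_apply, LinearMap.applyₗ_apply_apply, Module.End.mul_apply]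
  generalize TensorAlgebra.lift k (frontStep c) z (1, 0) = y at h ⊢
  simp [frontStep, h]

theorem cross_tmul_one (c : V ⊗[k] V →ₗ[k] V ⊗[k] V) (v w : V) :
    cross c (v ⊗ₜ (w ⊗ₜ 1)) = LinearMap.lTensor V (TensorAlgebra.ι k) (c (v ⊗ₜ w)) := by
  simp only [cross, LinearMap.comp_apply, LinearEquiv.coe_coe, TensorProduct.assoc_symm_tmul,
    LinearMap.rTensor_tmul]
  induction c (v ⊗ₜ w) using TensorProduct.induction_on with
  | zero => simp
  | tmul a b => simp [mulLeft_tmul]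
  | add a b ha hb => rw [TensorProduct.add_tmul, map_add, map_add, ha, hb, map_add]

theorem front_quadratic (c : V ⊗[k] V →ₗ[k] V ⊗[k] V) (z : V ⊗[k] V) :
    front c (quadratic z) = LinearMap.lTensor V (TensorAlgebra.ι k) (z + c z) := by
  induction z using TensorProduct.induction_on with
  | zero => simp
  | tmul v w =>
    have hw : front c (TensorAlgebra.ι k w) = w ⊗ₜ 1 := by
      simpa [front_one] using front_ι_mul c w 1
    simp [quadratic, mulLeft_tmul, front_ι_mul, hw, cross_tmul_one]
  | add a b ha hb =>
    rw [map_add, map_add, ha, hb, ← map_add, map_add c]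
    congr 1
    abel

theorem algebraMapInv_quadratic (z : V ⊗[k] V) :
    TensorAlgebra.algebraMapInv (quadratic z) = 0 := by
  induction z using TensorProduct.induction_on with
  | zero => simp
  | tmul v w => simp [quadratic, mulLeft_tmul, TensorAlgebra.algebraMapInv]
  | add a b ha hb => rw [map_add, map_add, ha, hb, add_zero]

/-- The product `V ⊗ V → 𝔅(V)` of the generators. -/
def NicholsAlgebra.quadratic (c : V ⊗[k] V →ₗ[k] V ⊗[k] V) : V ⊗[k] V →ₗ[k] NicholsAlgebra c :=
  TensorProduct.lift ((LinearMap.mul k (NicholsAlgebra c)).compl₁₂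
    (NicholsAlgebra.ι c) (NicholsAlgebra.ι c))

theorem NicholsAlgebra.quadratic_tmul (c : V ⊗[k] V →ₗ[k] V ⊗[k] V) (v w : V) :
    NicholsAlgebra.quadratic c (v ⊗ₜ w) = NicholsAlgebra.ι c v * NicholsAlgebra.ι c w := rfl

/-- The kernel of `𝔖₂ = 1 + c` gives quadratic relations. The quadratic element is in the kernel of
all the symmetrizers because each one of positive degree factors through `front`. -/
theorem NicholsAlgebra.quadratic_eq_zero {c : V ⊗[k] V →ₗ[k] V ⊗[k] V} {z : V ⊗[k] V}
    (hz : z + c z = 0) : NicholsAlgebra.quadratic c z = 0 := by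
  let π := RingQuot.mkAlgHom k (fun x y : TensorAlgebra k V => ∀ m, qSymm c m x = qSymm c m y)
  have hπ : NicholsAlgebra.quadratic c z = π (Nichols.quadratic z) := by
    have : NicholsAlgebra.quadratic c = π.toLinearMap ∘ₗ Nichols.quadratic := by
      ext v w
      exact (map_mul π _ _).symm
    rw [this]
    rfl
  refine hπ.trans ((RingQuot.mkAlgHom_rel k fun m => ?_).trans (map_zero π))
  rw [map_zero]
  cases m with
  | zero => simp [qSymm, algebraMapInv_quadratic]
  | succ m => simp only [qSymm, LinearMap.comp_apply, front_quadratic, hz, map_zero]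

/-- A three-term relation between vectors whose tensors `v₁ ⊗ v₂`, `v₂ ⊗ v₃`, `v₃ ⊗ v₁` are permuted
cyclically by the braiding, up to scalars. -/
theorem NicholsAlgebra.cyclic_relation {c : V ⊗[k] V →ₗ[k] V ⊗[k] V} {v₁ v₂ v₃ : V}
    {w₁ w₂ w₃ : k} (h₁ : c (v₁ ⊗ₜ v₂) = w₁ • v₃ ⊗ₜ v₁) (h₂ : c (v₂ ⊗ₜ v₃) = w₂ • v₁ ⊗ₜ v₂)
    (h₃ : c (v₃ ⊗ₜ v₁) = w₃ • v₂ ⊗ₜ v₃) (h : w₂ * w₁ * w₃ = -1) :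
    ι c v₁ * ι c v₂ + (w₁ * w₃) • (ι c v₂ * ι c v₃) + (-w₁) • (ι c v₃ * ι c v₁) = 0 := by
  simp only [← quadratic_tmul, ← map_smul, ← map_add]
  refine quadratic_eq_zero ?_
  simp only [map_add, map_smul, h₁, h₂, h₃]
  linear_combination (norm := module) h • (v₁ ⊗ₜ[k] v₂)

theorem NicholsAlgebra.mul_eq_smul_mul {c : V ⊗[k] V →ₗ[k] V ⊗[k] V} {v₁ v₂ : V} {w₁ w₂ : k}
    (h₁ : c (v₁ ⊗ₜ v₂) = w₁ • v₂ ⊗ₜ v₁) (h₂ : c (v₂ ⊗ₜ v₁) = w₂ • v₁ ⊗ₜ v₂) (h : w₁ * w₂ = 1) :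
    ι c v₁ * ι c v₂ = w₁ • (ι c v₂ * ι c v₁) := by
  rw [← sub_eq_zero]
  simp only [← quadratic_tmul, ← map_smul, ← map_sub]
  refine quadratic_eq_zero ?_
  simp only [map_sub, map_smul, h₁, h₂]
  linear_combination (norm := module) -h • (v₁ ⊗ₜ[k] v₂)

end Nichols

/-! ### Products of two generators -/

namespace BiOne

variable {G : Type*} [Group G] {k : Type*} [Field k] {s : G}

theorem braiding_single (R : Reps s) (χ : Cent s →* kˣ) (t t' : Orb s) :
    braiding R χ (Finsupp.single t 1 ⊗ₜ Finsupp.single t' 1) =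
      ((χ (zeta R t' (t : G)⁻¹)⁻¹ : kˣ) : k) •
        (Finsupp.single (conj (t : G) t') (1 : k) ⊗ₜ[k] Finsupp.single t (1 : k)) := by
  rw [TensorProduct.smul_tmul', Finsupp.smul_single, smul_eq_mul, mul_one]
  simp [braiding, act]

theorem conj_eq {t t' t'' : Orb s} (h : (t * t' : G) = t'' * t) : conj (t : G) t' = t'' :=
  Subtype.ext (by simp [conj, h])

theorem zeta_one (R : Reps s) (t : Orb s) : zeta R t 1 = 1 := by
  have h : conj (1 : G)⁻¹ t = t := Subtype.ext (by simp [conj])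
  refine Subtype.ext ?_
  change R.rep t * 1 * (R.rep (conj (1 : G)⁻¹ t))⁻¹ = 1
  rw [h, mul_one, mul_inv_cancel]

/-- A 2-path is determined by its vertices. -/
theorem CoPath.of_congr (R : Reps s) (χ : Cent s →* kˣ) {x y z x' y' z' : HopfQuiver s}
    (a : x ⟶ y) (b : y ⟶ z) (a' : x' ⟶ y') (b' : y' ⟶ z')
    (hx : x = x') (hy : y = y') (hz : z = z') :
    CoPath.of R χ ((Quiver.Path.nil.cons a).cons b) =
      CoPath.of R χ ((Quiver.Path.nil.cons a').cons b') := by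
  subst hx hy hz
  obtain rfl : a = a' := PLift.down_injective (Subsingleton.elim _ _)
  obtain rfl : b = b' := PLift.down_injective (Subsingleton.elim _ _)
  rfl

theorem pathVia₂_eq_pathVia₁ (R : Reps s) (χ : Cent s →* kˣ) {t t' t'' : Orb s}
    (h : (t * t' : G) = t' * t'') : pathVia₂ R χ t t' = pathVia₁ R χ t' t'' :=
  CoPath.of_congr R χ _ _ _ _ rfl rfl h

theorem CoPath.of_mul_of (R : Reps s) (χ : Cent s →* kˣ) {x y x' y' : HopfQuiver s}
    (p : Quiver.Path x y) (q : Quiver.Path x' y') :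
    CoPath.of R χ p * CoPath.of R χ q = (CoPath.equiv R χ).symm
      ((pathMul R χ p q).mapDomain fun r => ⟨x * x', y * y', r⟩) := by
  change (CoPath.equiv R χ).symm (pathMulₗ R χ (Finsupp.single ⟨x, y, p⟩ 1)
    (Finsupp.single ⟨x', y', q⟩ 1)) = _
  simp [pathMulₗ]

theorem arr_mul_arr (R : Reps s) (χ : Cent s →* kˣ) (t t' : Orb s) :
    arr R χ t * arr R χ t' =
      ((χ (zeta R t (t' : G)) : kˣ) : k) • pathVia₂ R χ t t' + pathVia₁ R χ t t' := by
  have ht : arrowType (arrowOne t) = t :=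
    Subtype.ext (by change (1 : G)⁻¹ * (t : G) = t; simp)
  rw [arr, arr, CoPath.of_mul_of]
  have h1 : pathVia₂ R χ t t' = CoPath.of R χ ((Quiver.Path.nil.cons
      (arrowL (vtx s 1) (arrowOne t'))).cons (arrowR (arrowOne t) (vtx s t'))) :=
    CoPath.of_congr R χ _ _ _ _ (one_mul (1 : G)).symm (one_mul (t' : G)).symm rfl
  have h2 : pathVia₁ R χ t t' = CoPath.of R χ ((Quiver.Path.nil.cons
      (arrowR (arrowOne t) (vtx s 1))).cons (arrowL (vtx s t) (arrowOne t'))) :=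
    CoPath.of_congr R χ _ _ _ _ (one_mul (1 : G)).symm (mul_one (t : G)).symm rfl
  rw [h1, h2]
  simp only [pathMul, ht, zeta_one, map_one, Units.val_one, one_smul, Finsupp.mapDomain_single,
    Finsupp.mapDomain_add, Finsupp.mapDomain_smul, map_add, map_smul]
  rfl

/-! ### Relations from a product of scalars -/

theorem mem_signs {u : kˣ} (h : u = 1 ∨ u = -1) : (u : k) ∈ ({1, -1} : Set k) := by
  rcases h with rfl | rfl <;> simp

theorem neg_mem_signs {u : k} (h : u ∈ ({1, -1} : Set k)) : -u ∈ ({1, -1} : Set k) := by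
  rcases h with rfl | rfl <;> simp

theorem mul_mem_signs {u v : k} (hu : u ∈ ({1, -1} : Set k)) (hv : v ∈ ({1, -1} : Set k)) :
    u * v ∈ ({1, -1} : Set k) := by
  rcases hu with rfl | rfl <;> rcases hv with rfl | rfl <;> simp

theorem threeTerm_arr (R : Reps s) (χ : Cent s →* kˣ) (hχ : ∀ γ, χ γ = 1 ∨ χ γ = -1)
    {t₁ t₂ t₃ : Orb s} (h₁ : (t₁ * t₂ : G) = t₂ * t₃) (h₂ : (t₂ * t₃ : G) = t₃ * t₁)
    (h : ((χ (zeta R t₁ t₂) : kˣ) : k) * (χ (zeta R t₂ t₃) : kˣ) * (χ (zeta R t₃ t₁) : kˣ) = -1) :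
    ThreeTerm k (arr R χ t₁) (arr R χ t₂) (arr R χ t₃) := by
  have m₁ := mem_signs (hχ (zeta R t₁ t₂))
  have m₂ := mem_signs (hχ (zeta R t₂ t₃))
  refine ⟨_, neg_mem_signs m₁, _, mul_mem_signs m₁ m₂, ?_⟩
  rw [arr_mul_arr, arr_mul_arr, arr_mul_arr, pathVia₂_eq_pathVia₁ R χ h₁,
    pathVia₂_eq_pathVia₁ R χ h₂, pathVia₂_eq_pathVia₁ R χ (h₂.symm.trans h₁.symm)]
  linear_combination (norm := module) h • pathVia₁ R χ t₁ t₂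

theorem threeTerm_gen (R : Reps s) (χ : Cent s →* kˣ) (hχ : ∀ γ, χ γ = 1 ∨ χ γ = -1)
    {t₁ t₂ t₃ : Orb s} (h₁ : (t₁ * t₂ : G) = t₂ * t₃) (h₂ : (t₂ * t₃ : G) = t₃ * t₁)
    (h : ((χ (zeta R t₃ (t₂ : G)⁻¹)⁻¹ : kˣ) : k) * (χ (zeta R t₂ (t₁ : G)⁻¹)⁻¹ : kˣ) *
      (χ (zeta R t₁ (t₃ : G)⁻¹)⁻¹ : kˣ) = -1) :
    ThreeTerm k (gen R χ t₁) (gen R χ t₂) (gen R χ t₃) := by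
  have m₁ := mem_signs (hχ (zeta R t₂ (t₁ : G)⁻¹)⁻¹)
  have m₃ := mem_signs (hχ (zeta R t₁ (t₃ : G)⁻¹)⁻¹)
  have b₁ := braiding_single R χ t₁ t₂
  have b₂ := braiding_single R χ t₂ t₃
  have b₃ := braiding_single R χ t₃ t₁
  rw [conj_eq (h₁.trans h₂)] at b₁
  rw [conj_eq h₁.symm] at b₂
  rw [conj_eq h₂.symm] at b₃
  exact ⟨_, mul_mem_signs m₁ m₃, _, neg_mem_signs m₁,
    Nichols.NicholsAlgebra.cyclic_relation b₁ b₂ b₃ h⟩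

theorem signCommute_arr (R : Reps s) (χ : Cent s →* kˣ) (hχ : ∀ γ, χ γ = 1 ∨ χ γ = -1)
    {t t' : Orb s} (ht : (t * t' : G) = t' * t)
    (h : ((χ (zeta R t t') : kˣ) : k) * (χ (zeta R t' t) : kˣ) = 1) :
    SignCommute k (arr R χ t) (arr R χ t') := by
  refine ⟨_, mem_signs (hχ (zeta R t t')), ?_⟩
  rw [arr_mul_arr, arr_mul_arr, pathVia₂_eq_pathVia₁ R χ ht, pathVia₂_eq_pathVia₁ R χ ht.symm]
  linear_combination (norm := module) -h • pathVia₁ R χ t t'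

theorem signCommute_gen (R : Reps s) (χ : Cent s →* kˣ) (hχ : ∀ γ, χ γ = 1 ∨ χ γ = -1)
    {t t' : Orb s} (ht : (t * t' : G) = t' * t)
    (h : ((χ (zeta R t' (t : G)⁻¹)⁻¹ : kˣ) : k) * (χ (zeta R t (t' : G)⁻¹)⁻¹ : kˣ) = 1) :
    SignCommute k (gen R χ t) (gen R χ t') := by
  have b₁ := braiding_single R χ t t'
  have b₂ := braiding_single R χ t' t
  rw [conj_eq ht] at b₁
  rw [conj_eq ht.symm] at b₂
  exact ⟨_, mem_signs (hχ _), Nichols.NicholsAlgebra.mul_eq_smul_mul b₁ b₂ h⟩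

end BiOne

/-! ### The characters on the elements `ζ` -/

namespace Transp

open Equiv

theorem swap_mul_swap_cycle {α : Type*} [DecidableEq α] {i j k : α} (hij : i ≠ j) (hki : k ≠ i) :
    swap i j * swap j k = swap j k * swap k i := by
  rw [mul_swap_eq_swap_mul (swap j k), swap_apply_right, swap_apply_of_ne_of_ne hij hki.symm,
    swap_comm j i]

theorem swap_mul_swap_comm {α : Type*} [DecidableEq α] {i j k l : α} (hik : i ≠ k)
    (hil : i ≠ l) (hjk : j ≠ k) (hjl : j ≠ l) :
    swap i j * swap k l = swap k l * swap i j := by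
  rw [mul_swap_eq_swap_mul, swap_apply_of_ne_of_ne hik.symm hjk.symm,
    swap_apply_of_ne_of_ne hil.symm hjl.symm]

variable {n : ℕ} [n.AtLeastTwo]

theorem t_symm {i j : Fin n} (h : i ≠ j) : t h.symm = t h := Subtype.ext (swap_comm _ _)

/-- The sign of `S_n` restricts to `sgn ⊗ sgn`. -/
theorem sign_resRest_mul_sign_resTwo (c : BiOne.Cent (σ n)) :
    Perm.sign (resRest n c) * Perm.sign (resTwo n c) = Perm.sign (c : Perm (Fin n)) := by
  have h : (c : Perm (Fin n)) =
      Perm.ofSubtype (resRest n c) * Perm.ofSubtype (resTwo n c) := by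
    ext1 x
    rw [Perm.mul_apply]
    by_cases hx : x = 0 ∨ x = 1
    · rw [Perm.ofSubtype_apply_of_mem (resTwo n c) hx, Perm.ofSubtype_apply_of_not_mem]
      · rfl
      · exact fun hn => hn ((mem_cent_iff c.2 x).2 hx)
    · rw [Perm.ofSubtype_apply_of_not_mem (resTwo n c) hx,
        Perm.ofSubtype_apply_of_mem (resRest n c) hx]
      rfl
  rw [h, map_mul, Perm.sign_ofSubtype, Perm.sign_ofSubtype]

/-- The sign `1` on the letter `1` and `-1` on the other ones, which records one of the two
orderings of `{1, 2}`. -/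
def orient (x : Fin n) : ℤˣ := if x = 0 then 1 else -1

theorem orient_mul_self (x : Fin n) : orient x * orient x = 1 := Int.units_mul_self _

theorem sign_resTwo (c : BiOne.Cent (σ n)) {x : Fin n} (hx : x = 0 ∨ x = 1) :
    Perm.sign (resTwo n c) = orient ((c : Perm (Fin n)) x) * orient x := by
  have h01 := zero_ne_one' (n := n)
  let p : {x : Fin n // x = 0 ∨ x = 1} := ⟨0, Or.inl rfl⟩
  let q : {x : Fin n // x = 0 ∨ x = 1} := ⟨1, Or.inr rfl⟩
  have hpq : p ≠ q := fun e => h01 (congrArg Subtype.val e)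
  have hall : ∀ y : {x : Fin n // x = 0 ∨ x = 1}, y = p ∨ y = q := fun y =>
    y.2.imp (fun e => Subtype.ext e) (fun e => Subtype.ext e)
  have hp : ((resTwo n c p : {x : Fin n // x = 0 ∨ x = 1}) : Fin n) =
    (c : Perm (Fin n)) 0 := rfl
  have hq : ((resTwo n c q : {x : Fin n // x = 0 ∨ x = 1}) : Fin n) =
    (c : Perm (Fin n)) 1 := rfl
  rcases hall (resTwo n c p) with e | e
  · have e' : resTwo n c q = q := (hall _).resolve_left fun e' =>
      hpq ((resTwo n c).injective (e.trans e'.symm))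
    have hc : resTwo n c = 1 := by
      ext1 y
      rcases hall y with rfl | rfl <;> simp [e, e']
    rw [e] at hp
    rw [e'] at hq
    rw [hc, map_one]
    rcases hx with rfl | rfl
    · rw [← hp]; exact (orient_mul_self _).symm
    · rw [← hq]; exact (orient_mul_self _).symm
  · have e' : resTwo n c q = p := (hall _).resolve_right fun e' =>
      hpq ((resTwo n c).injective (e.trans e'.symm))
    have hc : resTwo n c = swap p q := by
      ext1 y
      rcases hall y with rfl | rfl <;> simp [e, e']
    rw [e] at hp
    rw [e'] at hq
    rw [hc, Perm.sign_swap hpq]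
    rcases hx with rfl | rfl
    · rw [← hp]; simp [orient, q, h01.symm]
    · rw [← hq]; simp [orient, p, h01.symm]

theorem rep_apply_left (R : BiOne.Reps (σ n)) {i j : Fin n} (h : i ≠ j) :
    R.rep (t h) i = 0 ∨ R.rep (t h) i = 1 := by
  have hs : (R.rep (t h))⁻¹ * σ n * R.rep (t h) = swap i j := R.rep_spec (t h)
  by_contra! hc
  have := congrArg (fun p : Perm (Fin n) => p i) hs
  simp only [Perm.mul_apply, swap_apply_of_ne_of_ne hc.1 hc.2, swap_apply_left] at this
  exact h (((R.rep (t h)).symm_apply_apply i).symm.trans this)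

/-- The representative of `t_{ij}` gives opposite orientations to the ends of the edge `i j`. -/
theorem orient_rep_mul (R : BiOne.Reps (σ n)) {i j : Fin n} (h : i ≠ j) :
    orient (R.rep (t h) i) * orient (R.rep (t h) j) = -1 := by
  have h01 := zero_ne_one' (n := n)
  have hi := rep_apply_left R h
  have hj := rep_apply_left R h.symm
  rw [t_symm h] at hj
  have hne : R.rep (t h) i ≠ R.rep (t h) j := fun e => h ((R.rep (t h)).injective e)
  rcases hi with hi | hi <;> rcases hj with hj | hj
  · exact absurd (hi.trans hj.symm) hne
  · simp [hi, hj, orient, h01.symm]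
  · simp [hi, hj, orient, h01.symm]
  · exact absurd (hi.trans hj.symm) hne

theorem conj_inv_t {i j i' j' : Fin n} (h : i ≠ j) (h' : i' ≠ j') (τ : Perm (Fin n))
    (hi : τ i' = i) (hj : τ j' = j) : BiOne.conj τ⁻¹ (t h) = t h' := by
  refine Subtype.ext ?_
  change τ⁻¹ * swap i j * τ⁻¹⁻¹ = swap i' j'
  rw [← swap_apply_apply, ← hi, ← hj]
  exact congrArg₂ swap (τ.symm_apply_apply i') (τ.symm_apply_apply j')

/-- A scalar compares the orientations of two edges at corresponding ends. -/
theorem sign_resTwo_zeta (R : BiOne.Reps (σ n)) {i j i' j' : Fin n} (h : i ≠ j) (h' : i' ≠ j')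
    (τ : Perm (Fin n)) (hi : τ i' = i) (hj : τ j' = j) :
    Perm.sign (resTwo n (BiOne.zeta R (t h) τ)) =
      orient (R.rep (t h) i) * orient (R.rep (t h') i') := by
  rw [sign_resTwo _ (rep_apply_left R h')]
  simp [BiOne.zeta, conj_inv_t h h' τ hi hj, hi]

theorem sign_zeta (R : BiOne.Reps (σ n)) {i j i' j' : Fin n} (h : i ≠ j) (h' : i' ≠ j')
    (τ : Perm (Fin n)) (hi : τ i' = i) (hj : τ j' = j) :
    Perm.sign (BiOne.zeta R (t h) τ : Perm (Fin n)) =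
      Perm.sign (R.rep (t h)) * Perm.sign τ * Perm.sign (R.rep (t h')) := by
  simp [BiOne.zeta, conj_inv_t h h' τ hi hj]

/-- The integral form of the characters `sgn ⊗ sgn` and `ε ⊗ sgn`: the sign of the permutation, or
the sign of its restriction to `{1, 2}`. -/
def IsSignChar (δ : BiOne.Cent (σ n) → ℤˣ) : Prop :=
  (∀ c, δ c = Perm.sign (c : Perm (Fin n))) ∨ ∀ c, δ c = Perm.sign (resTwo n c)

theorem IsSignChar.triple {δ : BiOne.Cent (σ n) → ℤˣ} (hδ : IsSignChar δ)
    (R : BiOne.Reps (σ n)) {i j k : Fin n} (hij : i ≠ j) (hjk : j ≠ k) (hki : k ≠ i) :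
    δ (BiOne.zeta R (t hij) (swap j k)) * δ (BiOne.zeta R (t hjk) (swap k i)) *
      δ (BiOne.zeta R (t hki) (swap i j)) = -1 := by
  have e₁ := swap_apply_of_ne_of_ne hij hki.symm
  have e₂ := swap_apply_of_ne_of_ne hjk hij.symm
  have e₃ := swap_apply_of_ne_of_ne hki hjk.symm
  rcases hδ with hδ | hδ
  · rw [hδ, hδ, hδ, sign_zeta R hij hki.symm _ e₁ (swap_apply_right _ _),
      sign_zeta R hjk hij.symm _ e₂ (swap_apply_right _ _),
      sign_zeta R hki hjk.symm _ e₃ (swap_apply_right _ _), t_symm hki, t_symm hij, t_symm hjk,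
      Perm.sign_swap hij, Perm.sign_swap hjk, Perm.sign_swap hki]
    generalize Perm.sign (R.rep (t hij)) = a
    generalize Perm.sign (R.rep (t hjk)) = b
    generalize Perm.sign (R.rep (t hki)) = c
    revert a b c
    decide
  · rw [hδ, hδ, hδ, sign_resTwo_zeta R hij hki.symm _ e₁ (swap_apply_right _ _),
      sign_resTwo_zeta R hjk hij.symm _ e₂ (swap_apply_right _ _),
      sign_resTwo_zeta R hki hjk.symm _ e₃ (swap_apply_right _ _), t_symm hki, t_symm hij, t_symm hjk]
    -- each edge of the triangle appears with both of its ends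
    calc _ = (orient (R.rep (t hij) i) * orient (R.rep (t hij) j)) *
          (orient (R.rep (t hjk) j) * orient (R.rep (t hjk) k)) *
          (orient (R.rep (t hki) k) * orient (R.rep (t hki) i)) := by
          ac_rfl
      _ = -1 := by rw [orient_rep_mul, orient_rep_mul, orient_rep_mul]; rfl

theorem IsSignChar.disjoint {δ : BiOne.Cent (σ n) → ℤˣ} (hδ : IsSignChar δ)
    (R : BiOne.Reps (σ n)) {i j k l : Fin n} (hij : i ≠ j) (hkl : k ≠ l)
    (hik : i ≠ k) (hil : i ≠ l) (hjk : j ≠ k) (hjl : j ≠ l) :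
    δ (BiOne.zeta R (t hij) (swap k l)) * δ (BiOne.zeta R (t hkl) (swap i j)) = 1 := by
  have ei := swap_apply_of_ne_of_ne hik hil
  have ej := swap_apply_of_ne_of_ne hjk hjl
  have ek := swap_apply_of_ne_of_ne hik.symm hjk.symm
  have el := swap_apply_of_ne_of_ne hil.symm hjl.symm
  rcases hδ with hδ | hδ
  · rw [hδ, hδ, sign_zeta R hij hij _ ei ej, sign_zeta R hkl hkl _ ek el,
      Perm.sign_swap hij, Perm.sign_swap hkl]
    generalize Perm.sign (R.rep (t hij)) = a
    generalize Perm.sign (R.rep (t hkl)) = b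
    revert a b
    decide
  · rw [hδ, hδ, sign_resTwo_zeta R hij hij _ ei ej, sign_resTwo_zeta R hkl hkl _ ek el,
      orient_mul_self, orient_mul_self, one_mul]

theorem exists_isSignChar {k : Type*} [Field k] {χ : BiOne.Cent (σ n) →* kˣ}
    (hχ : χ = sgnSgn k n ∨ χ = epsSgn k n) :
    ∃ δ : BiOne.Cent (σ n) →* ℤˣ, IsSignChar δ ∧
      χ = (Units.map (Int.castRingHom k).toMonoidHom).comp δ := by
  rcases hχ with rfl | rfl
  · exact ⟨_, Or.inl fun c => sign_resRest_mul_sign_resTwo c, rfl⟩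
  · exact ⟨_, Or.inr fun c => one_mul _, rfl⟩

section

variable {k : Type*} [Field k] {χ : BiOne.Cent (σ n) →* kˣ}

theorem char_eq_one_or (hχ : χ = sgnSgn k n ∨ χ = epsSgn k n) (γ : BiOne.Cent (σ n)) :
    χ γ = 1 ∨ χ γ = -1 := by
  obtain ⟨δ, -, rfl⟩ := exists_isSignChar hχ
  rcases Int.units_eq_one_or (δ γ) with h | h
  · left; simp [h]
  · right; ext; simp [h]

theorem char_inv (hχ : χ = sgnSgn k n ∨ χ = epsSgn k n) (γ : BiOne.Cent (σ n)) :
    χ γ⁻¹ = χ γ := by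
  rw [map_inv]
  rcases char_eq_one_or hχ γ with h | h <;> simp [h]

theorem chiZeta_triple (hχ : χ = sgnSgn k n ∨ χ = epsSgn k n) {i j l : Fin n}
    (hij : i ≠ j) (hjl : j ≠ l) (hli : l ≠ i) :
    chiZeta χ hij (swap j l) * chiZeta χ hjl (swap l i) * chiZeta χ hli (swap i j) = -1 := by
  obtain ⟨δ, hδ, rfl⟩ := exists_isSignChar hχ
  have h := congrArg (fun u : ℤˣ => ((u : ℤ) : k)) (hδ.triple (reps n) hij hjl hli)
  simpa [chiZeta] using h

theorem chiZeta_disjoint (hχ : χ = sgnSgn k n ∨ χ = epsSgn k n) {i j l m : Fin n}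
    (hij : i ≠ j) (hlm : l ≠ m) (hil : i ≠ l) (him : i ≠ m) (hjl : j ≠ l) (hjm : j ≠ m) :
    chiZeta χ hij (swap l m) * chiZeta χ hlm (swap i j) = 1 := by
  obtain ⟨δ, hδ, rfl⟩ := exists_isSignChar hχ
  have h := congrArg (fun u : ℤˣ => ((u : ℤ) : k))
    (hδ.disjoint (reps n) hij hlm hil him hjl hjm)
  simpa [chiZeta] using h

theorem threeTerm_a (hχ : χ = sgnSgn k n ∨ χ = epsSgn k n) {i j l : Fin n}
    (hij : i ≠ j) (hjl : j ≠ l) (hli : l ≠ i) :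
    ThreeTerm k (a χ hij) (a χ hjl) (a χ hli) :=
  BiOne.threeTerm_arr _ _ (char_eq_one_or hχ) (swap_mul_swap_cycle hij hli)
    (swap_mul_swap_cycle hjl hij) (chiZeta_triple hχ hij hjl hli)

theorem threeTerm_x (hχ : χ = sgnSgn k n ∨ χ = epsSgn k n) {i j l : Fin n}
    (hij : i ≠ j) (hjl : j ≠ l) (hli : l ≠ i) :
    ThreeTerm k (x χ hij) (x χ hjl) (x χ hli) := by
  refine BiOne.threeTerm_gen _ _ (char_eq_one_or hχ) (swap_mul_swap_cycle hij hli)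
    (swap_mul_swap_cycle hjl hij) ?_
  simp only [char_inv hχ]
  -- the braiding traverses the triangle in the opposite direction
  have h := chiZeta_triple hχ (i := l) (j := j) (l := i) hjl.symm hij.symm hli.symm
  rw [chiZeta, chiZeta, chiZeta, t_symm hjl, t_symm hij, t_symm hli] at h
  rw [swap_comm j i, swap_comm i l, swap_comm l j] at h
  simp only [t, swap_inv]
  simp only [t] at h
  linear_combination h

theorem signCommute_a (hχ : χ = sgnSgn k n ∨ χ = epsSgn k n) {i j l m : Fin n}
    (hij : i ≠ j) (hlm : l ≠ m) (hil : i ≠ l) (him : i ≠ m) (hjl : j ≠ l) (hjm : j ≠ m) :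
    SignCommute k (a χ hij) (a χ hlm) :=
  BiOne.signCommute_arr _ _ (char_eq_one_or hχ) (swap_mul_swap_comm hil him hjl hjm)
    (chiZeta_disjoint hχ hij hlm hil him hjl hjm)

theorem signCommute_x (hχ : χ = sgnSgn k n ∨ χ = epsSgn k n) {i j l m : Fin n}
    (hij : i ≠ j) (hlm : l ≠ m) (hil : i ≠ l) (him : i ≠ m) (hjl : j ≠ l) (hjm : j ≠ m) :
    SignCommute k (x χ hij) (x χ hlm) := by
  refine BiOne.signCommute_gen _ _ (char_eq_one_or hχ) (swap_mul_swap_comm hil him hjl hjm) ?_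
  have h := chiZeta_disjoint hχ hij hlm hil him hjl hjm
  simp only [chiZeta, t] at h
  simp only [char_inv hχ, t, swap_inv]
  linear_combination h

end

end Transp

theorem lemma5p2 (n : ℕ) [n.AtLeastTwo] (χ : BiOne.Cent (Transp.σ n) →* ℂˣ)
    (hχ : χ = Transp.sgnSgn ℂ n ∨ χ = Transp.epsSgn ℂ n) :
    -- (i)
    (∀ (i j k : Fin n) (hij : i ≠ j) (hjk : j ≠ k) (hki : k ≠ i),
      ThreeTerm ℂ (Transp.x χ hij) (Transp.x χ hjk) (Transp.x χ hki) ∧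
      ThreeTerm ℂ (Transp.a χ hij) (Transp.a χ hjk) (Transp.a χ hki)) ∧
    -- (ii)
    (∀ (i j k : Fin n) (hij : i ≠ j) (hjk : j ≠ k) (hki : k ≠ i),
      ∀ α ∈ ({1, -1} : Set ℂ), ∀ β ∈ ({1, -1} : Set ℂ),
      Transp.a χ hij * Transp.a χ hjk + α • (Transp.a χ hjk * Transp.a χ hki) +
          β • (Transp.a χ hki * Transp.a χ hij) =
        (Transp.chiZeta χ hij (Transp.t hjk) •
            BiOne.pathVia₂ (Transp.reps n) χ (Transp.t hij) (Transp.t hjk) +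
          BiOne.pathVia₁ (Transp.reps n) χ (Transp.t hij) (Transp.t hjk)) +
        α • (Transp.chiZeta χ hjk (Transp.t hki.symm) •
            BiOne.pathVia₂ (Transp.reps n) χ (Transp.t hjk) (Transp.t hki.symm) +
          BiOne.pathVia₁ (Transp.reps n) χ (Transp.t hjk) (Transp.t hki.symm)) +
        β • (Transp.chiZeta χ hki.symm (Transp.t hij) •
            BiOne.pathVia₂ (Transp.reps n) χ (Transp.t hki.symm) (Transp.t hij) +
          BiOne.pathVia₁ (Transp.reps n) χ (Transp.t hki.symm) (Transp.t hij))) ∧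
    -- (iii)
    (∀ (i j k : Fin n) (hij : i ≠ j) (hjk : j ≠ k) (hki : k ≠ i),
      Transp.chiZeta χ hij (Transp.t hjk) * Transp.chiZeta χ hjk (Transp.t hki.symm) *
          Transp.chiZeta χ hki.symm (Transp.t hij) = -1 →
        ThreeTerm ℂ (Transp.x χ hij) (Transp.x χ hjk) (Transp.x χ hki) ∧
        ThreeTerm ℂ (Transp.a χ hij) (Transp.a χ hjk) (Transp.a χ hki)) ∧
    -- (iv)
    (∀ (i j k : Fin n) (hij : i ≠ j) (hjk : j ≠ k) (hki : k ≠ i),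
      (ThreeTerm ℂ (Transp.x χ hij) (Transp.x χ hjk) (Transp.x χ hki) ↔
        Transp.chiZeta χ hij (Transp.t hjk) * Transp.chiZeta χ hjk (Transp.t hki.symm) *
          Transp.chiZeta χ hki.symm (Transp.t hij) = -1) ∧
      (ThreeTerm ℂ (Transp.a χ hij) (Transp.a χ hjk) (Transp.a χ hki) ↔
        Transp.chiZeta χ hij (Transp.t hjk) * Transp.chiZeta χ hjk (Transp.t hki.symm) *
          Transp.chiZeta χ hki.symm (Transp.t hij) = -1)) ∧
    -- (v)
    (∀ (i j k l : Fin n) (hij : i ≠ j) (hkl : k ≠ l),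
      i ≠ k → i ≠ l → j ≠ k → j ≠ l →
      SignCommute ℂ (Transp.x χ hij) (Transp.x χ hkl) ∧
      SignCommute ℂ (Transp.a χ hij) (Transp.a χ hkl)) := by
  have hprod : ∀ (i j k : Fin n) (hij : i ≠ j) (hjk : j ≠ k) (hki : k ≠ i),
      Transp.chiZeta χ hij (Transp.t hjk) * Transp.chiZeta χ hjk (Transp.t hki.symm) *
        Transp.chiZeta χ hki.symm (Transp.t hij) = -1 := by
    intro i j k hij hjk hki
    have h := Transp.chiZeta_triple hχ hij hjk hki
    rw [Transp.t_symm hki]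
    simp only [Transp.chiZeta, Transp.t_symm hki] at h ⊢
    exact h
  have hthree := fun (i j k : Fin n) (hij : i ≠ j) (hjk : j ≠ k) (hki : k ≠ i) =>
    And.intro (Transp.threeTerm_x hχ hij hjk hki) (Transp.threeTerm_a hχ hij hjk hki)
  refine ⟨hthree, ?_, fun i j k hij hjk hki _ => hthree i j k hij hjk hki,
    fun i j k hij hjk hki => ?_, fun i j k l hij hkl hik hil hjk hjl =>
      ⟨Transp.signCommute_x hχ hij hkl hik hil hjk hjl,
        Transp.signCommute_a hχ hij hkl hik hil hjk hjl⟩⟩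
  · intro i j k hij hjk hki α _ β _
    rw [Transp.t_symm hki, Transp.a, Transp.a, Transp.a, BiOne.arr_mul_arr, BiOne.arr_mul_arr,
      BiOne.arr_mul_arr]
    simp only [Transp.chiZeta, Transp.t_symm hki]
  · exact ⟨iff_of_true (hthree i j k hij hjk hki).1 (hprod i j k hij hjk hki),
      iff_of_true (hthree i j k hij hjk hki).2 (hprod i j k hij hjk hki)⟩
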